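/- Let $n$ and $k\ge 2$ be positive integers and write $[n]=\{1,\ldots,n\}$. For a vector $\vec t=(t_1,\ldots,t_k)$ of positive integers, call a $k$-element subset $A=\{A(1)<A(2)<\cdots<A(k)\}$ of $[n]$ *$\vec t$-stable* if $t_j\le A(j+1)-A(j)$ for $1\le j\le k-1$ and $A(k)-A(1)\le n-t_k$. Let $P(n,k,\vec t)$ be the poset of all pairs $(A,B)$ of disjoint subsets of $[n]$ such that each of $A$ and $B$ contains a $\vec t$-stable $k$-set, ordered by $(A_1,B_1)\le (A_2,B_2)$ if and only if $A_1\subseteq A_2$ and $B_1\subseteq B_2$. For a poset $P$ let $\Delta(P)$ denote its order complex, that is, the simplicial complex whose vertices are the elements of $P$ and whose simplices are the nonempty finite chains of $P$. Theorem. Let $k\ge 2$, let $s_1,\ldots,s_{k-1}\ge 2$ be integers, and put $\vec s=(s_1,\ldots,s_{k-1},1)$ and $\vec s_*=(s_1,\ldots,s_{k-1},2)$. If $n\ge \sum_{i=1}^{k-1}s_i+2$, then (the geometric realizations of) $\Delta(P(n,k,\vec s))$ and $\Delta(P(n,k,\vec s_*))$ are homotopy equivalent. -/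

import Mathlib

/-- The vector `(s₁, …, s_{k-1}, t)` of length `k` obtained from `(s₁, …, s_{k-1})`
by adding the last entry `t`. -/
def appendLast {k : ℕ} (s : Fin (k - 1) → ℕ) (t : ℕ) : Fin k → ℕ :=
  fun i => if h : (i : ℕ) < k - 1 then s ⟨i, h⟩ else t

/-- `A` is an `s`-stable `k`-subset of `[n]`. The ground set `[n] = {1, …, n}` is modelled by
`Fin n` (a shift by one, under which differences do not change), and
`A.orderEmbOfFin h` lists the elements `A(1) < ⋯ < A(k)` of `A`, with positions counted from `0`.
The two clauses are `s_j ≤ A(j+1) - A(j)` for `1 ≤ j ≤ k-1` and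
`A(k) - A(1) ≤ n - s_k` (inequalities of integers, written without subtraction). -/
def IsStable {n k : ℕ} (s : Fin k → ℕ) (A : Finset (Fin n)) : Prop :=
  ∃ h : A.card = k,
    (∀ i j : Fin k, (j : ℕ) = i + 1 →
      (A.orderEmbOfFin h i : ℕ) + s i ≤ (A.orderEmbOfFin h j : ℕ)) ∧
    (∀ first last : Fin k, (first : ℕ) = 0 → (last : ℕ) + 1 = k →
      (A.orderEmbOfFin h last : ℕ) + s last ≤ (A.orderEmbOfFin h first : ℕ) + n)

/-- The poset `P(n, k, s)` of pairs `(A, B)` of disjoint subsets of `[n]` each of which contains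
an `s`-stable `k`-set; the order is the one inherited from the product,
`(A₁, B₁) ≤ (A₂, B₂) ↔ A₁ ⊆ A₂ ∧ B₁ ⊆ B₂`. -/
abbrev StablePairs (n k : ℕ) (s : Fin k → ℕ) : Type :=
  {p : Finset (Fin n) × Finset (Fin n) //
    Disjoint p.1 p.2 ∧ (∃ S ⊆ p.1, IsStable s S) ∧ (∃ S ⊆ p.2, IsStable s S)}

noncomputable instance (n k : ℕ) (s : Fin k → ℕ) : Fintype (StablePairs n k s) :=
  Fintype.ofFinite _

theorem stablePairs_le_iff {n k : ℕ} {s : Fin k → ℕ} (p q : StablePairs n k s) :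
    p ≤ q ↔ p.1.1 ⊆ q.1.1 ∧ p.1.2 ⊆ q.1.2 :=
  Iff.rfl

/-- The order complex `Δ(P)`: its vertices are the elements of `P`, its simplices the nonempty
finite chains of `P`. -/
def orderComplex (P : Type*) [PartialOrder P] : AbstractSimplicialComplex P where
  faces := {F | F.Nonempty ∧ IsChain (· ≤ ·) (F : Set P)}
  isRelLowerSet_faces := fun _ hF =>
    ⟨hF.1, fun _ hGF hG => ⟨hG, hF.2.mono (Finset.coe_subset.mpr hGF)⟩⟩
  singleton_mem v := ⟨Finset.singleton_nonempty v, by simp⟩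

/-- The (geometric realization of the) simplicial complex `K` on a finite vertex set `V`: the
points of the standard simplex of `ℝ^V` supported on a face of `K`, with the topology
induced from `ℝ^V`. -/
abbrev GeometricRealization {V : Type*} [Fintype V] (K : AbstractSimplicialComplex V) : Type _ :=
  {x : V → ℝ // x ∈ stdSimplex ℝ V ∧ ∃ F ∈ K.faces, ∀ v, x v ≠ 0 → v ∈ F}

/-!
The proof works inside the poset of all pairs of disjoint subsets of `[n]`. With `u`, `u₀` standing
for "contains a stable set" with respect to the last entries `1` and `2`, and `disjointPairs u v`
for the pairs `(A, B)` with `u A` and `v B`, the condition on `A` is strengthened from `u` to `u₀`,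
the two coordinates are exchanged, and the condition on the other set is strengthened likewise.

*Homotopy.* All homotopy equivalences come from one deformation of realizations: if each simplex of
`K` through `σ` can be enlarged by a fixed vertex `w ∉ σ`, then the open star of `σ` can be removed
(`Realization.homotopyEquiv_of_collapse`). By induction this allows the removal of an element from
a poset when the elements below it, or those above it, form a set that is contractible in the
combinatorial sense of `Contr` (`Contr.canRemoveStar`, `Red.homotopyEquiv`).

*Strengthening the first condition* (`red_disjointPairs`). The pairs `(A, B)` without `u₀ A` are
removed from the largest to the smallest. If the complement of `B` satisfies `u₀`, then the pairs
still present above `(A, B)` contract, through those with second set `B`, to `(Bᶜ, B)`. Otherwise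
nothing need survive above `(A, B)`, and the pairs below it are used: they form a join with a factor
for `A` and a factor for `B`, so that it suffices that the sets `B' ⊂ B` with `v B'` are
contractible.

*Combinatorics* (`contr_hasGaps_of_covers`). Let the complement `C` of `B` contain stable sets, but
only such as contain both `1` and `n`. The leftmost sequence `1 = e₁ < ⋯ < e_k = n` in `C` with
`e_j + s_j ≤ e_{j+1}` shows that `B` avoids all the `e_j` and contains the intervals
`[e_j + s_j, e_{j+1})`. The smallest element `d` of `B` is then removed, and induction applies, in a
generality in which the sequence in `C` has gaps from a final segment only of the gaps required
in `B`. The sets avoiding `d` are those of the same kind for `B \ {d}`. For the sets containing `d`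
there are two cases. An element of `B` closer than the first gap to `d` is redundant, since `d` can
begin any sequence; otherwise such sets amount to subsets of `B \ {d}` with the first gap deleted.
The assumption that gaps are at least `2` makes `d + 1` redundant when `d` and `d + 1` lie in the
same interval.
-/

/-! ### Realizations and generalized collapses -/

/-- The realization of a family `K` of subsets of `α` (to be thought of as the simplices of a
simplicial complex, possibly together with the empty set): the points of the standard simplex
whose support belongs to `K`. -/
abbrev Realization {α : Type*} [Fintype α] (K : Set (Set α)) : Type _ :=
  {x : α → ℝ // x ∈ stdSimplex ℝ α ∧ Function.support x ∈ K}

/-- Move the amount `c` from each vertex of `σ` to the vertex `w`. -/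
noncomputable def shiftTo {α : Type*} [DecidableEq α] (σ : Finset α) (w : α) (c : ℝ) (x : α → ℝ) :
    α → ℝ :=
  fun v => x v + c * ((if v = w then (σ.card : ℝ) else 0) - if v ∈ σ then 1 else 0)

section Collapse

variable {α : Type*} [DecidableEq α] {σ : Finset α} {w : α}

@[simp]
theorem shiftTo_zero (σ : Finset α) (w : α) (x : α → ℝ) : shiftTo σ w 0 x = x := by
  funext v
  simp [shiftTo]

theorem shiftTo_mem_stdSimplex [Fintype α] (hw : w ∉ σ) {x : α → ℝ} (hx : x ∈ stdSimplex ℝ α)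
    {c : ℝ} (hc : 0 ≤ c) (hcx : ∀ v ∈ σ, c ≤ x v) : shiftTo σ w c x ∈ stdSimplex ℝ α := by
  refine ⟨fun v => ?_, ?_⟩
  · have h0 := hx.1 v
    unfold shiftTo
    by_cases hv : v ∈ σ
    · have : v ≠ w := fun h => hw (h ▸ hv)
      simp only [this, hv, if_true, if_false]
      linarith [hcx v hv]
    · simp only [hv, if_false, sub_zero]
      split_ifs <;> positivity
  · simp only [shiftTo, Finset.sum_add_distrib, hx.2, ← Finset.mul_sum, Finset.sum_sub_distrib,
      Finset.sum_ite_eq', Finset.mem_univ, if_true, Finset.sum_ite_mem, Finset.univ_inter,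
      Finset.sum_const, nsmul_eq_mul, mul_one, sub_self, mul_zero, add_zero]

theorem support_shiftTo_subset {x : α → ℝ} {c : ℝ} (h : (σ : Set α) ⊆ Function.support x) :
    Function.support (shiftTo σ w c x) ⊆ insert w (Function.support x) := by
  intro v hv
  by_cases hvw : v = w
  · exact Or.inl hvw
  · refine Or.inr fun hxv => hv ?_
    have hvσ : v ∉ σ := fun hvσ => h hvσ hxv
    simp [shiftTo, hvw, hvσ, hxv]

/-- If every simplex of `K` containing `σ` can be enlarged by the vertex `w ∉ σ`, then `K` deforms
onto the subcomplex of the simplices that do not contain `σ`: a point loses the minimum of its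
coordinates on `σ` at each vertex of `σ`, in favour of `w`. -/
theorem Realization.homotopyEquiv_of_collapse [Fintype α] {K : Set (Set α)} (hK : IsLowerSet K)
    (hσ : σ.Nonempty) (hw : w ∉ σ) (h : ∀ τ ∈ K, (σ : Set α) ⊆ τ → insert w τ ∈ K) :
    Nonempty (ContinuousMap.HomotopyEquiv (Realization K)
      (Realization {τ ∈ K | ¬ (σ : Set α) ⊆ τ})) := by
  let m : (α → ℝ) → ℝ := fun x => σ.inf' hσ x
  have hm_cont : Continuous m := by
    have := Continuous.finset_inf'_apply (X := α → ℝ) (L := ℝ) (s := σ) hσ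
      (f := fun v x => x v) (fun v _ => continuous_apply v)
    exact this
  have hm_le : ∀ (x : α → ℝ), ∀ v ∈ σ, m x ≤ x v := fun x v hv => Finset.inf'_le _ hv
  have hm_nonneg : ∀ x ∈ stdSimplex ℝ α, 0 ≤ m x := fun x hx =>
    (Finset.le_inf'_iff hσ _).2 fun v _ => hx.1 v
  have hm_sub : ∀ x ∈ stdSimplex ℝ α, m x ≠ 0 → (σ : Set α) ⊆ Function.support x := by
    intro x hx hne v hv hxv
    exact hne (le_antisymm (hxv ▸ hm_le x v hv) (hm_nonneg x hx))
  have hm_zero : ∀ x ∈ stdSimplex ℝ α, ¬ (σ : Set α) ⊆ Function.support x → m x = 0 :=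
    fun x hx hns => by_contra fun hne => hns (hm_sub x hx hne)
  have hmem : ∀ x ∈ stdSimplex ℝ α, Function.support x ∈ K → ∀ t : ℝ, 0 ≤ t → t ≤ 1 →
      shiftTo σ w (t * m x) x ∈ stdSimplex ℝ α ∧
        Function.support (shiftTo σ w (t * m x) x) ∈ K := by
    intro x hx hxK t ht0 ht1
    have hm0 := hm_nonneg x hx
    refine ⟨shiftTo_mem_stdSimplex hw hx (mul_nonneg ht0 hm0) fun v hv =>
      (mul_le_of_le_one_left hm0 ht1).trans (hm_le x v hv), ?_⟩
    by_cases hne : m x = 0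
    · simpa [hne] using hxK
    · have hs := hm_sub x hx hne
      exact hK (support_shiftTo_subset hs) (h _ hxK hs)
  have hshift_cont : Continuous fun q : ℝ × (α → ℝ) => shiftTo σ w (q.1 * m q.2) q.2 := by
    unfold shiftTo
    fun_prop
  let r : C(Realization K, Realization {τ ∈ K | ¬ (σ : Set α) ⊆ τ}) :=
    { toFun := fun x => ⟨shiftTo σ w (1 * m x.1) x.1,
        (hmem x.1 x.2.1 x.2.2 1 zero_le_one le_rfl).1,
        (hmem x.1 x.2.1 x.2.2 1 zero_le_one le_rfl).2, fun hsub => by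
          obtain ⟨v, hv, hvm⟩ := Finset.exists_mem_eq_inf' hσ x.1
          refine hsub hv ?_
          have hvw : v ≠ w := fun e => hw (e ▸ hv)
          have : m x.1 = x.1 v := hvm
          simp [shiftTo, hvw, hv, this]⟩
      continuous_toFun := by
        refine Continuous.subtype_mk ?_ _
        exact hshift_cont.comp (continuous_const.prodMk continuous_subtype_val) }
  let i : C(Realization {τ ∈ K | ¬ (σ : Set α) ⊆ τ}, Realization K) :=
    { toFun := fun x => ⟨x.1, x.2.1, x.2.2.1⟩
      continuous_toFun := by fun_prop }
  refine ⟨⟨r, i, ?_, ?_⟩⟩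
  · refine ContinuousMap.Homotopic.symm ⟨⟨⟨fun q => ⟨shiftTo σ w ((q.1 : ℝ) * m q.2.1) q.2.1,
      hmem q.2.1 q.2.2.1 q.2.2.2 q.1 q.1.2.1 q.1.2.2⟩, ?_⟩, ?_, ?_⟩⟩
    · refine Continuous.subtype_mk ?_ _
      exact hshift_cont.comp ((continuous_subtype_val.comp continuous_fst).prodMk
        (continuous_subtype_val.comp continuous_snd))
    · intro x
      apply Subtype.ext
      simp
    · intro x
      rfl
  · have : r.comp i = ContinuousMap.id _ := by
      ext1 x
      apply Subtype.ext
      have : m x.1 = 0 := hm_zero x.1 x.2.1 x.2.2.2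
      simp [r, i, this]
    rw [this]

end Collapse

/-- An injective map of vertex sets that matches the simplices of two complexes induces a
homeomorphism of realizations. -/
theorem Realization.nonempty_homeomorph_of_injective {α β : Type*} [Fintype α] [Fintype β]
    {f : α → β} (hf : Function.Injective f) {K : Set (Set α)} {K' : Set (Set β)}
    (h : K' = (fun τ => f '' τ) '' K) :
    Nonempty (Realization K ≃ₜ Realization K') := by
  subst h
  have hsum : ∀ x : α → ℝ, ∑ b, Function.extend f x 0 b = ∑ a, x a := by
    intro x
    refine (Finset.sum_of_injOn f hf.injOn (fun _ _ => Finset.mem_univ _) ?_ ?_).symm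
    · intro b _ hb
      exact Function.extend_apply' _ _ _ fun ⟨a, ha⟩ => hb ⟨a, by simp, ha⟩
    · intro a _
      exact (hf.extend_apply _ _ _).symm
  have hsupp : ∀ x : α → ℝ, Function.support (Function.extend f x 0) = f '' Function.support x := by
    intro x
    ext b
    by_cases hb : ∃ a, f a = b
    · obtain ⟨a, rfl⟩ := hb
      simp [hf.extend_apply, hf.eq_iff]
    · rw [Function.mem_support, Function.extend_apply' _ _ _ hb]
      simp only [Pi.zero_apply, ne_eq, not_true_eq_false, false_iff]
      rintro ⟨a, -, rfl⟩
      exact hb ⟨a, rfl⟩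
  have hext : ∀ y : Realization ((fun τ => f '' τ) '' K),
      Function.extend f (fun a => y.1 (f a)) 0 = y.1 := by
    intro y
    obtain ⟨τ, -, hτ⟩ := y.2.2
    funext b
    by_cases hb : ∃ a, f a = b
    · obtain ⟨a, rfl⟩ := hb
      rw [hf.extend_apply]
    · rw [Function.extend_apply' _ _ _ hb]
      by_contra hne
      have : b ∈ Function.support y.1 := fun e => hne (by simp [e])
      rw [← hτ] at this
      obtain ⟨a, -, rfl⟩ := this
      exact hb ⟨a, rfl⟩
  refine ⟨⟨⟨fun x => ⟨Function.extend f x.1 0, ⟨fun b => ?_, ?_⟩, ?_⟩,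
    fun y => ⟨fun a => y.1 (f a), ⟨fun a => y.2.1.1 _, ?_⟩, ?_⟩, fun x => ?_, fun y => ?_⟩, ?_, ?_⟩⟩
  · by_cases hb : ∃ a, f a = b
    · obtain ⟨a, rfl⟩ := hb
      rw [hf.extend_apply]
      exact x.2.1.1 a
    · rw [Function.extend_apply' _ _ _ hb]
      rfl
  · rw [hsum]
    exact x.2.1.2
  · rw [hsupp]
    exact ⟨_, x.2.2, rfl⟩
  · rw [← hsum, hext]
    exact y.2.1.2
  · have h1 := y.2.2
    rw [← hext y, hsupp] at h1
    obtain ⟨τ, hτ, hτ'⟩ := h1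
    exact hf.image_injective hτ' ▸ hτ
  · apply Subtype.ext
    funext a
    exact hf.extend_apply _ _ _
  · exact Subtype.ext (hext y)
  · refine Continuous.subtype_mk (continuous_pi fun b => ?_) _
    by_cases hb : ∃ a, f a = b
    · obtain ⟨a, rfl⟩ := hb
      simp only [hf.extend_apply]
      exact (continuous_apply a).comp continuous_subtype_val
    · simp only [Function.extend_apply' _ _ _ hb]
      exact continuous_const
  · exact Continuous.subtype_mk (continuous_pi fun a =>
      (continuous_apply (A := fun _ => ℝ) (f a)).comp continuous_subtype_val) _

/-! ### Removing elements with contractible links from a poset -/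

/-- A combinatorial form of contractibility for a subset `R` of a partially ordered set: `R` is a
cone, or it becomes contractible after the removal of an element below or above which `R` is
contractible. -/
inductive Contr {α : Type*} [PartialOrder α] : Set α → Prop
  | cone {R : Set α} (w : α) (hw : w ∈ R) (h : ∀ x ∈ R, x ≤ w ∨ w ≤ x) : Contr R
  | lower {R : Set α} (x : α) (hx : x ∈ R) (hl : Contr {y ∈ R | y < x}) (h : Contr (R \ {x})) :
      Contr R
  | upper {R : Set α} (x : α) (hx : x ∈ R) (hl : Contr {y ∈ R | x < y}) (h : Contr (R \ {x})) :
      Contr R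

/-- `Red R R'`: the subset `R'` arises from `R` by removing elements one by one, each of which has,
at the time of its removal, a contractible set of smaller or of larger elements. -/
inductive Red {α : Type*} [PartialOrder α] : Set α → Set α → Prop
  | refl (R : Set α) : Red R R
  | step {R R' : Set α} (x : α) (hx : x ∈ R)
      (hl : Contr {y ∈ R | y < x} ∨ Contr {y ∈ R | x < y}) (h : Red (R \ {x}) R') : Red R R'

/-- The chains in `R`, the empty one included. -/
def chainsIn {α : Type*} [PartialOrder α] (R : Set α) : Set (Set α) :=
  {τ | τ ⊆ R ∧ IsChain (· ≤ ·) τ}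

section Poset

variable {α : Type*} [PartialOrder α]

theorem isLowerSet_chainsIn (R : Set α) : IsLowerSet (chainsIn R) :=
  fun _ _ hba ha => ⟨hba.trans ha.1, ha.2.mono hba⟩

theorem Red.contr {R R' : Set α} (h : Red R R') (hR' : Contr R') : Contr R := by
  induction h with
  | refl => exact hR'
  | step x hx hl _ ih =>
    exact hl.elim (fun h => .lower x hx h (ih hR')) (fun h => .upper x hx h (ih hR'))

theorem Contr.image {β : Type*} [PartialOrder β] {f : α → β} {R : Set α} (h : Contr R)
    (hf : ∀ x ∈ R, ∀ y ∈ R, f x ≤ f y ↔ x ≤ y) : Contr (f '' R) := by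
  have hlt : ∀ {R : Set α}, (∀ x ∈ R, ∀ y ∈ R, f x ≤ f y ↔ x ≤ y) →
      ∀ x ∈ R, ∀ y ∈ R, f x < f y ↔ x < y := by
    intro R hf x hx y hy
    rw [lt_iff_le_not_ge, lt_iff_le_not_ge, hf x hx y hy, hf y hy x hx]
  have hsd : ∀ {R : Set α}, (∀ x ∈ R, ∀ y ∈ R, f x ≤ f y ↔ x ≤ y) →
      ∀ x ∈ R, f '' R \ {f x} = f '' (R \ {x}) := by
    intro R hf x hx
    ext b
    constructor
    · rintro ⟨⟨y, hy, rfl⟩, hne⟩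
      exact ⟨y, ⟨hy, fun e => hne (by rw [Set.mem_singleton_iff.1 e]; rfl)⟩, rfl⟩
    · rintro ⟨y, ⟨hy, hne⟩, rfl⟩
      refine ⟨⟨y, hy, rfl⟩, fun e => hne ?_⟩
      have e : f y = f x := e
      exact le_antisymm ((hf y hy x hx).1 e.le) ((hf x hx y hy).1 e.ge)
  induction h with
  | cone w hw h =>
    refine .cone (f w) ⟨w, hw, rfl⟩ ?_
    rintro _ ⟨x, hx, rfl⟩
    rw [hf x hx w hw, hf w hw x hx]
    exact h x hx
  | @lower R x hx _ _ ihl ih =>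
    refine .lower (f x) ⟨x, hx, rfl⟩ ?_ ?_
    · have : {y ∈ f '' R | y < f x} = f '' {y ∈ R | y < x} := by
        ext b
        constructor
        · rintro ⟨⟨y, hy, rfl⟩, h⟩
          exact ⟨y, ⟨hy, (hlt hf y hy x hx).1 h⟩, rfl⟩
        · rintro ⟨y, ⟨hy, h⟩, rfl⟩
          exact ⟨⟨y, hy, rfl⟩, (hlt hf y hy x hx).2 h⟩
      rw [this]
      exact ihl fun y hy z hz => hf y hy.1 z hz.1
    · rw [hsd hf x hx]
      exact ih fun y hy z hz => hf y hy.1 z hz.1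
  | @upper R x hx _ _ ihl ih =>
    refine .upper (f x) ⟨x, hx, rfl⟩ ?_ ?_
    · have : {y ∈ f '' R | f x < y} = f '' {y ∈ R | x < y} := by
        ext b
        constructor
        · rintro ⟨⟨y, hy, rfl⟩, h⟩
          exact ⟨y, ⟨hy, (hlt hf x hx y hy).1 h⟩, rfl⟩
        · rintro ⟨y, ⟨hy, h⟩, rfl⟩
          exact ⟨⟨y, hy, rfl⟩, (hlt hf x hx y hy).2 h⟩
      rw [this]
      exact ihl fun y hy z hz => hf y hy.1 z hz.1
    · rw [hsd hf x hx]
      exact ih fun y hy z hz => hf y hy.1 z hz.1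

/-- Removing the elements of `S` from the largest to the smallest. -/
theorem Red.of_topDown [Finite α] {R S : Set α} (hS : S ⊆ R)
    (h : ∀ x ∈ S, Contr {y ∈ R | y < x} ∨ Contr {y ∈ R \ S | x < y}) : Red R (R \ S) := by
  induction hm : S.ncard generalizing R S with
  | zero =>
    rw [(Set.ncard_eq_zero S.toFinite).1 hm, Set.sdiff_empty]
    exact .refl R
  | succ m ih =>
    have hne : S.Nonempty := (Set.ncard_pos S.toFinite).1 (by omega)
    obtain ⟨x, hx⟩ := S.toFinite.exists_maximal hne
    have hmax : ∀ y ∈ S, ¬ x < y := fun y hy hxy => hx.not_gt hy hxy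
    have hdiff : (R \ {x}) \ (S \ {x}) = R \ S := by
      ext y
      have : y = x → y ∈ S := fun e => e ▸ hx.1
      simp only [Set.mem_sdiff, Set.mem_singleton_iff]
      tauto
    refine .step x (hS hx.1) ?_ ?_
    · refine (h x hx.1).imp_right fun hc => ?_
      convert hc using 3 with y
      refine and_congr_left fun hxy => ⟨fun hy => ⟨hy, fun hyS => hmax y hyS hxy⟩, And.left⟩
    · rw [← hdiff]
      refine ih (Set.sdiff_subset_sdiff_left hS) (fun y hy => ?_) ?_
      · rw [hdiff]
        refine (h y hy.1).imp_left fun hc => ?_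
        convert hc using 3 with z
        exact and_congr_left fun hzy => ⟨And.left, fun hz => ⟨hz, fun e =>
          hmax y hy.1 (Set.mem_singleton_iff.1 e ▸ hzy)⟩⟩
      · rw [Set.ncard_sdiff_singleton_of_mem hx.1, hm, Nat.add_sub_cancel]

/-- Removing the elements of `S` from the smallest to the largest. -/
theorem Red.of_bottomUp [Finite α] {R S : Set α} (hS : S ⊆ R)
    (h : ∀ x ∈ S, Contr {y ∈ R \ S | y < x}) : Red R (R \ S) := by
  induction hm : S.ncard generalizing R S with
  | zero =>
    rw [(Set.ncard_eq_zero S.toFinite).1 hm, Set.sdiff_empty]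
    exact .refl R
  | succ m ih =>
    have hne : S.Nonempty := (Set.ncard_pos S.toFinite).1 (by omega)
    obtain ⟨x, hx⟩ := S.toFinite.exists_minimal hne
    have hdiff : (R \ {x}) \ (S \ {x}) = R \ S := by
      ext y
      have : y = x → y ∈ S := fun e => e ▸ hx.1
      simp only [Set.mem_sdiff, Set.mem_singleton_iff]
      tauto
    refine .step x (hS hx.1) (.inl ?_) ?_
    · convert h x hx.1 using 3 with y
      exact and_congr_left fun hyx => ⟨fun hy => ⟨hy, fun hyS => hx.not_lt hyS hyx⟩, And.left⟩
    · rw [← hdiff]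
      refine ih (Set.sdiff_subset_sdiff_left hS) (fun y hy => ?_) ?_
      · rw [hdiff]
        exact h y hy.1
      · rw [Set.ncard_sdiff_singleton_of_mem hx.1, hm, Nat.add_sub_cancel]

/-- The simplices of the order complex of `R` that contain `x` are the joins of a chain below `x`
and a chain of the other elements through `x`. -/
theorem isChain_inter_of_lower {R τ : Set α} {x : α} (hx : x ∈ R) (hxτ : x ∈ τ)
    (h1 : IsChain (· ≤ ·) (τ ∩ {y ∈ R | y < x}))
    (h2 : IsChain (· ≤ ·) ((τ \ {y ∈ R | y < x}) ∩ R)) : IsChain (· ≤ ·) (τ ∩ R) := by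
  have hge : ∀ y ∈ τ ∩ R, ¬ y < x → x ≤ y := fun y hy hyx => by
    rcases eq_or_ne y x with rfl | hne
    · exact le_rfl
    · rcases h2 ⟨⟨hy.1, fun h => hyx h.2⟩, hy.2⟩ ⟨⟨hxτ, fun h => lt_irrefl _ h.2⟩, hx⟩ hne
        with h | h
      · exact absurd (lt_of_le_of_ne h hne) hyx
      · exact h
  intro y hy z hz hyz
  by_cases hyx : y < x <;> by_cases hzx : z < x
  · exact h1 ⟨hy.1, hy.2, hyx⟩ ⟨hz.1, hz.2, hzx⟩ hyz
  · exact .inl (hyx.le.trans (hge z hz hzx))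
  · exact .inr (hzx.le.trans (hge y hy hyx))
  · exact h2 ⟨⟨hy.1, fun h => hyx h.2⟩, hy.2⟩ ⟨⟨hz.1, fun h => hzx h.2⟩, hz.2⟩ hyz

theorem isChain_inter_of_upper {R τ : Set α} {x : α} (hx : x ∈ R) (hxτ : x ∈ τ)
    (h1 : IsChain (· ≤ ·) (τ ∩ {y ∈ R | x < y}))
    (h2 : IsChain (· ≤ ·) ((τ \ {y ∈ R | x < y}) ∩ R)) : IsChain (· ≤ ·) (τ ∩ R) :=
  (isChain_inter_of_lower (α := αᵒᵈ) (x := OrderDual.toDual x) hx hxτ h1.symm h2.symm).symm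

/-- The link of `σ` in `K` is the join of the order complex of `R` with some other complex. -/
def IsJoinLink (K : Set (Set α)) (σ : Finset α) (R : Set α) : Prop :=
  (∀ v ∈ σ, v ∉ R) ∧
    ∀ τ : Set α, (σ : Set α) ⊆ τ → (τ ∈ K ↔ IsChain (· ≤ ·) (τ ∩ R) ∧ τ \ R ∈ K)

/-- The open star of a simplex can be removed from a complex without changing the homotopy type
whenever the order complex of `R` is a join factor of the link of the simplex. -/
def CanRemoveStar [Fintype α] (R : Set α) : Prop :=
  ∀ (K : Set (Set α)) (σ : Finset α), IsLowerSet K → σ.Nonempty → IsJoinLink K σ R →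
    Nonempty (ContinuousMap.HomotopyEquiv (Realization K)
      (Realization {τ ∈ K | ¬ (σ : Set α) ⊆ τ}))

/-- The open star of `σ` is removed in two steps, starting with the simplices through `x`. -/
theorem CanRemoveStar.of_sdiff_singleton [Fintype α] {R Q : Set α} {x : α} (hx : x ∈ R)
    (hxQ : x ∉ Q) (hQR : Q ⊆ R)
    (hsplit : ∀ τ : Set α, x ∈ τ → IsChain (· ≤ ·) (τ ∩ Q) → IsChain (· ≤ ·) ((τ \ Q) ∩ R) →
      IsChain (· ≤ ·) (τ ∩ R))
    (hQ : CanRemoveStar Q) (hR : CanRemoveStar (R \ {x})) : CanRemoveStar R := by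
  classical
  intro K σ hK hσ hlink
  have hins : ∀ τ : Set α, ((insert x σ : Finset α) : Set α) ⊆ τ ↔ x ∈ τ ∧ (σ : Set α) ⊆ τ :=
    fun τ => by rw [Finset.coe_insert, Set.insert_subset_iff]
  have hlow : IsLowerSet {τ ∈ K | ¬ ((insert x σ : Finset α) : Set α) ⊆ τ} :=
    fun a b hba ha => ⟨hK hba ha.1, fun h => ha.2 (h.trans hba)⟩
  obtain ⟨e₁⟩ := hQ K (insert x σ) hK (Finset.insert_nonempty x σ) (by
    refine ⟨fun v hv => ?_, fun τ hτ => ?_⟩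
    · rcases Finset.mem_insert.1 hv with rfl | hv
      · exact hxQ
      · exact fun h => hlink.1 v hv (hQR h)
    · rw [hins] at hτ
      refine ⟨fun h => ⟨((hlink.2 τ hτ.2).1 h).1.mono (Set.inter_subset_inter_right _ hQR),
        hK Set.sdiff_subset h⟩, fun ⟨h1, h2⟩ => (hlink.2 τ hτ.2).2 ⟨hsplit τ hτ.1 h1 ?_,
          hK (Set.sdiff_subset_sdiff_right hQR) h2⟩⟩
      exact ((hlink.2 (τ \ Q) fun v hv => ⟨hτ.2 hv, fun h => hlink.1 v hv (hQR h)⟩).1 h2).1)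
  obtain ⟨e₂⟩ := hR _ σ hlow hσ (by
    refine ⟨fun v hv h => hlink.1 v hv h.1, fun τ hτ => ⟨fun h =>
      ⟨((hlink.2 τ hτ).1 h.1).1.mono (Set.inter_subset_inter_right _ Set.sdiff_subset),
        hlow Set.sdiff_subset h⟩, fun ⟨h1, h2⟩ => ?_⟩⟩
    have hxτ : x ∉ τ := fun hxτ => h2.2 ((hins _).2
      ⟨⟨hxτ, fun h => h.2 rfl⟩, fun v hv => ⟨hτ hv, fun h => hlink.1 v hv h.1⟩⟩)
    have hsub : τ ∩ R ⊆ τ ∩ (R \ {x}) := fun y hy =>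
      ⟨hy.1, hy.2, fun e => hxτ (Set.mem_singleton_iff.1 e ▸ hy.1)⟩
    exact ⟨(hlink.2 τ hτ).2 ⟨h1.mono hsub,
      hK (Set.sdiff_subset_sdiff_right Set.sdiff_subset) h2.1⟩, fun h => hxτ ((hins _).1 h).1⟩)
  have heq : {τ ∈ {τ ∈ K | ¬ ((insert x σ : Finset α) : Set α) ⊆ τ} | ¬ (σ : Set α) ⊆ τ} =
      {τ ∈ K | ¬ (σ : Set α) ⊆ τ} := by
    ext τ
    have := hins τ
    simp only [Set.mem_ofPred_eq]
    tauto
  rw [heq] at e₂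
  exact ⟨e₁.trans e₂⟩

theorem Contr.canRemoveStar [Fintype α] {R : Set α} (hR : Contr R) : CanRemoveStar R := by
  classical
  induction hR with
  | @cone R w hw h =>
    intro K σ hK hσ hlink
    refine Realization.homotopyEquiv_of_collapse hK hσ (fun hwσ => hlink.1 w hwσ hw)
      fun τ hτ hs => ?_
    refine (hlink.2 _ (hs.trans (Set.subset_insert _ _))).2 ⟨?_, hK ?_ hτ⟩
    · rw [Set.insert_inter_of_mem hw]
      exact ((hlink.2 τ hs).1 hτ).1.insert fun y hy _ => (h y hy.2).symm
    · rintro y ⟨rfl | hy, hyR⟩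
      · exact absurd hw hyR
      · exact hy
  | lower x hx _ _ ihl ih =>
    exact ihl.of_sdiff_singleton hx (fun h => lt_irrefl _ h.2) (fun _ h => h.1)
      (fun τ hxτ => isChain_inter_of_lower hx hxτ) ih
  | upper x hx _ _ ihl ih =>
    exact ihl.of_sdiff_singleton hx (fun h => lt_irrefl _ h.2) (fun _ h => h.1)
      (fun τ hxτ => isChain_inter_of_upper hx hxτ) ih

theorem Red.homotopyEquiv [Fintype α] {R R' : Set α} (h : Red R R') :
    Nonempty (ContinuousMap.HomotopyEquiv (Realization (chainsIn R))
      (Realization (chainsIn R'))) := by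
  induction h with
  | refl R => exact ⟨ContinuousMap.HomotopyEquiv.refl _⟩
  | @step R R' x hx hl _ ih =>
    obtain ⟨e₂⟩ := ih
    have heq : {τ ∈ chainsIn R | ¬ ((({x} : Finset α) : Set α)) ⊆ τ} = chainsIn (R \ {x}) := by
      ext τ
      simp only [chainsIn, Finset.coe_singleton, Set.singleton_subset_iff, Set.mem_ofPred_eq,
        Set.subset_sdiff, Set.disjoint_singleton_right]
      tauto
    have key : ∀ Q : Set α, Q ⊆ R → x ∉ Q → Contr Q →
        (∀ τ : Set α, x ∈ τ → IsChain (· ≤ ·) (τ ∩ Q) → IsChain (· ≤ ·) ((τ \ Q) ∩ R) →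
          IsChain (· ≤ ·) (τ ∩ R)) →
        Nonempty (ContinuousMap.HomotopyEquiv (Realization (chainsIn R))
          (Realization (chainsIn R'))) := by
      intro Q hQR hxQ hQ hsplit
      obtain ⟨e₁⟩ := hQ.canRemoveStar _ {x} (isLowerSet_chainsIn R)
        (Finset.singleton_nonempty x) (by
          refine ⟨by simpa using hxQ, fun τ hxτ => ⟨fun h =>
            ⟨h.2.mono Set.inter_subset_left, isLowerSet_chainsIn R Set.sdiff_subset h⟩,
            fun ⟨h1, h2⟩ => ?_⟩⟩
          have hτR : τ ⊆ R := fun y hy => by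
            by_cases hyQ : y ∈ Q
            · exact hQR hyQ
            · exact h2.1 ⟨hy, hyQ⟩
          refine ⟨hτR, ?_⟩
          have := hsplit τ (by simpa using hxτ) h1 (h2.2.mono Set.inter_subset_left)
          rwa [Set.inter_eq_left.2 hτR] at this)
      rw [heq] at e₁
      exact ⟨e₁.trans e₂⟩
    rcases hl with hl | hl
    · exact key _ (fun _ h => h.1) (fun h => lt_irrefl _ h.2) hl
        fun τ hxτ => isChain_inter_of_lower hx hxτ
    · exact key _ (fun _ h => h.1) (fun h => lt_irrefl _ h.2) hl
        fun τ hxτ => isChain_inter_of_upper hx hxτ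

end Poset

/-! ### Pairs of disjoint sets -/

/-- The pairs `(A, B)` of disjoint finite sets with `u A` and `v B`. -/
def disjointPairs {ι : Type*} (u v : Finset ι → Prop) : Set (Finset ι × Finset ι) :=
  {p | Disjoint p.1 p.2 ∧ u p.1 ∧ v p.2}

section Pairs

variable {ι : Type*} [Fintype ι] {u u₀ v : Finset ι → Prop}

/-- The pairs strictly below `(A, B)` are contractible if the sets strictly below `B` are: the set
of these pairs is a join with one factor for `A` and one for `B`. -/
theorem contr_pairs_lt {A B : Finset ι} (hA : u A) (hB : v B) (h : Contr {B' | B' ⊂ B ∧ v B'}) :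
    Contr {p : Finset ι × Finset ι | p < (A, B) ∧ u p.1 ∧ v p.2} := by
  induction A using Finset.strongInduction with
  | H A ih =>
    -- First the pairs `(A', B)` are removed, then the pairs `(A', B')` with `A' ≠ A`.
    refine (Red.of_topDown (S := {p | p < (A, B) ∧ u p.1 ∧ p.2 = B}) ?_ ?_).contr
      ((Red.of_topDown (S := {p | p.1 ⊂ A ∧ p.2 ⊂ B ∧ u p.1 ∧ v p.2}) ?_ ?_).contr ?_)
    · rintro ⟨A', B'⟩ ⟨h1, h2, rfl⟩
      exact ⟨h1, h2, hB⟩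
    · rintro ⟨A', B'⟩ ⟨h1, h2, h3⟩
      obtain rfl : B' = B := h3
      left
      have hA' : A' ⊂ A := by simpa [Prod.mk_lt_mk_iff_left] using h1
      convert ih A' hA' h2 using 3 with p
      constructor
      · rintro ⟨hp, hpx⟩
        exact ⟨hpx, hp.2⟩
      · rintro ⟨hpx, hp⟩
        exact ⟨⟨hpx.trans h1, hp⟩, hpx⟩
    · rintro ⟨A', B'⟩ ⟨h1, h2, h3, h4⟩
      exact ⟨⟨Prod.mk_lt_mk.2 (.inl ⟨h1, h2.le⟩), h3, h4⟩, fun h => h2.ne h.2.2⟩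
    · rintro ⟨A', B'⟩ ⟨h1, h2, h3, h4⟩
      right
      refine .cone (A, B') ⟨⟨⟨⟨Prod.mk_lt_mk.2 (.inr ⟨le_rfl, h2⟩), hA, h4⟩,
        fun h => h2.ne h.2.2⟩, fun h => h.1.ne rfl⟩, Prod.mk_lt_mk.2 (.inl ⟨h1, le_rfl⟩)⟩ ?_
      rintro ⟨A'', B''⟩ ⟨⟨⟨⟨k1, k2, k3⟩, k4⟩, k5⟩, k6⟩
      right
      have hle := Prod.mk_le_mk.1 k1.le
      have hB'' : B'' ⊂ B := lt_of_le_of_ne hle.2 fun e => k4 ⟨k1, k2, e⟩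
      have hA'' : A'' = A := by
        by_contra hne
        exact k5 ⟨lt_of_le_of_ne hle.1 hne, hB'', k2, k3⟩
      exact Prod.mk_le_mk.2 ⟨hA''.ge, (Prod.mk_le_mk.1 k6.le).2⟩
    · convert h.image (f := fun B' => (A, B')) (fun x _ y _ => by simp) using 1
      ext ⟨A'', B''⟩
      constructor
      · rintro ⟨⟨⟨k1, k2, k3⟩, k4⟩, k5⟩
        have hle := Prod.mk_le_mk.1 k1.le
        have hB'' : B'' ⊂ B := lt_of_le_of_ne hle.2 fun e => k4 ⟨k1, k2, e⟩
        have hA'' : A'' = A := by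
          by_contra hne
          exact k5 ⟨lt_of_le_of_ne hle.1 hne, hB'', k2, k3⟩
        exact ⟨B'', ⟨hB'', k3⟩, by rw [hA'']⟩
      · rintro ⟨B', ⟨hB', hv⟩, he⟩
        obtain ⟨rfl, rfl⟩ := Prod.mk.inj he
        exact ⟨⟨⟨Prod.mk_lt_mk.2 (.inr ⟨le_rfl, hB'⟩), hA, hv⟩, fun h => hB'.ne h.2.2⟩,
          fun h => h.1.ne rfl⟩

/-- Replacing the condition `u` on the first sets by a stronger condition `u₀`. For those `B` whose
complement does not satisfy `u₀`, no pair above `(A, B)` survives, and the pairs below have to be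
contractible. -/
theorem red_disjointPairs [DecidableEq ι] (hu₀ : ∀ A, u₀ A → u A) (hu : Monotone u)
    (hc : ∀ B, v B → u Bᶜ → ¬ u₀ Bᶜ → Contr {B' | B' ⊂ B ∧ v B'}) :
    Red (disjointPairs u v) (disjointPairs u₀ v) := by
  have hdiff : disjointPairs u v \ {p ∈ disjointPairs u v | ¬ u₀ p.1} = disjointPairs u₀ v := by
    ext p
    simp only [disjointPairs, Set.mem_sdiff, Set.mem_ofPred_eq]
    have := hu₀ p.1
    tauto
  rw [← hdiff]
  refine Red.of_topDown (Set.sep_subset _ _) ?_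
  rw [hdiff]
  rintro ⟨A, B⟩ ⟨⟨hAB, huA, hvB⟩, hA⟩
  have hAB : Disjoint A B := hAB
  have hA : ¬ u₀ A := hA
  have hABc : A ⊆ Bᶜ := fun a ha => Finset.mem_compl.2 (Finset.disjoint_left.1 hAB ha)
  by_cases hBc : u₀ Bᶜ
  · right
    -- Pairs `(A', B')` with `B' ≠ B` contract to `(A', B)`, and these to `(Bᶜ, B)`.
    refine (Red.of_bottomUp (S := {p ∈ disjointPairs u₀ v | (A, B) < p ∧ p.2 ≠ B}) ?_ ?_).contr
      (.cone (Bᶜ, B) ?_ ?_)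
    · rintro p ⟨h1, h2, -⟩
      exact ⟨h1, h2⟩
    · rintro ⟨A', B'⟩ ⟨⟨h1, h2, h3⟩, h4, h5⟩
      have hle := Prod.mk_le_mk.1 h4.le
      have hAA' : A ⊂ A' := lt_of_le_of_ne hle.1 fun e => hA (e ▸ h2)
      have hBB' : B ⊂ B' := lt_of_le_of_ne hle.2 (Ne.symm h5)
      refine .cone (A', B) ⟨⟨⟨⟨Finset.disjoint_of_subset_right hBB'.le h1, h2, hvB⟩,
        Prod.mk_lt_mk.2 (.inl ⟨hAA', le_rfl⟩)⟩, fun h => h.2.2 rfl⟩,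
        Prod.mk_lt_mk.2 (.inr ⟨le_rfl, hBB'⟩)⟩ ?_
      rintro ⟨A'', B''⟩ ⟨⟨⟨k1, k2⟩, k3⟩, k4⟩
      left
      have hB'' : B'' = B := by
        by_contra hne
        exact k3 ⟨k1, k2, hne⟩
      exact Prod.mk_le_mk.2 ⟨(Prod.mk_le_mk.1 k4.le).1, hB''.le⟩
    · refine ⟨⟨⟨?_, hBc, hvB⟩, Prod.mk_lt_mk.2 (.inl ⟨lt_of_le_of_ne hABc fun e =>
        hA (e ▸ hBc), le_rfl⟩)⟩, fun h => h.2.2 rfl⟩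
      exact Finset.disjoint_left.2 fun a ha => Finset.mem_compl.1 ha
    · rintro ⟨A', B'⟩ ⟨⟨k1, k2⟩, k3⟩
      left
      have hB' : B' = B := by
        by_contra hne
        exact k3 ⟨k1, k2, hne⟩
      subst hB'
      exact Prod.mk_le_mk.2 ⟨fun a ha => Finset.mem_compl.2 (Finset.disjoint_left.1 k1.1 ha),
        le_rfl⟩
  · left
    convert contr_pairs_lt huA hvB (hc B hvB (hu hABc huA) hBc) using 3 with p
    constructor
    · rintro ⟨hp, hlt⟩
      exact ⟨hlt, hp.2⟩
    · rintro ⟨hlt, hp⟩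
      have hle := Prod.le_def.1 hlt.le
      exact ⟨⟨Finset.disjoint_of_subset_left hle.1 (Finset.disjoint_of_subset_right hle.2 hAB),
        hp⟩, hlt⟩

/-- Exchanging the two sets of a pair. -/
theorem nonempty_homeomorph_disjointPairs_swap (u v : Finset ι → Prop) :
    Nonempty (Realization (chainsIn (disjointPairs u v)) ≃ₜ
      Realization (chainsIn (disjointPairs v u))) := by
  have hmem : ∀ {u v : Finset ι → Prop} {τ : Set (Finset ι × Finset ι)},
      τ ∈ chainsIn (disjointPairs u v) → Prod.swap '' τ ∈ chainsIn (disjointPairs v u) := by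
    rintro u v τ ⟨h1, h2⟩
    refine ⟨?_, ?_⟩
    · rintro _ ⟨p, hp, rfl⟩
      exact ⟨(h1 hp).1.symm, (h1 hp).2.2, (h1 hp).2.1⟩
    · rintro _ ⟨p, hp, rfl⟩ _ ⟨q, hq, rfl⟩ -
      exact (h2.total hp hq).imp Prod.swap_le_swap.2 Prod.swap_le_swap.2
  refine Realization.nonempty_homeomorph_of_injective Prod.swap_injective ?_
  ext τ
  constructor
  · intro h
    exact ⟨Prod.swap '' τ, hmem h, by simp [Set.image_image]⟩
  · rintro ⟨τ, h, rfl⟩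
    exact hmem h

end Pairs

/-! ### Subsets containing a sequence with prescribed gaps -/

section Gaps

variable {n : ℕ}

/-- `HasGaps L D`: the set `D` contains elements `a₀, …, a_m`, where `m` is the length of `L`, such
that `a_i + L_i ≤ a_{i+1}` for all `i < m`. -/
def HasGaps : List ℕ → Finset (Fin n) → Prop
  | [], D => D.Nonempty
  | g :: L, D => ∃ a ∈ D, HasGaps L (D.filter fun b => (a : ℕ) + g ≤ b)

/-- `Covers M a D`: there are `a = e₀, …, e_m`, where `m` is the length of `M`, with
`e_i + M_i ≤ e_{i+1}`, such that `D` has no element above `e_m`, contains none of `e₁, …, e_m`, and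
contains all `d` with `e_i + M_i ≤ d < e_{i+1}`. In other words, `e₁, …, e_m` is the leftmost
sequence with gaps `M` in the complement of `D` that follows `a`. -/
def Covers : List ℕ → ℕ → Finset (Fin n) → Prop
  | [], a, D => ∀ d ∈ D, (d : ℕ) ≤ a
  | g :: M, a, D => ∃ b : Fin n, a + g ≤ b ∧ (∀ d : Fin n, a + g ≤ d → d < b → d ∈ D) ∧ b ∉ D ∧
      Covers M b D

theorem HasGaps.mono {L : List ℕ} {D D' : Finset (Fin n)} (hDD' : D ⊆ D') (h : HasGaps L D) :
    HasGaps L D' := by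
  induction L generalizing D D' with
  | nil => exact Finset.Nonempty.mono hDD' h
  | cons g L ih =>
    obtain ⟨a, ha, h⟩ := h
    exact ⟨a, hDD' ha, ih (Finset.filter_subset_filter _ hDD') h⟩

theorem HasGaps.nonempty {L : List ℕ} {D : Finset (Fin n)} (h : HasGaps L D) : D.Nonempty := by
  cases L with
  | nil => exact h
  | cons g L =>
    obtain ⟨a, ha, -⟩ := h
    exact ⟨a, ha⟩

theorem Covers.congr {M : List ℕ} {a : ℕ} {D D' : Finset (Fin n)} (hM : ∀ g ∈ M, 1 ≤ g)
    (hDD' : ∀ d : Fin n, a < d → (d ∈ D ↔ d ∈ D')) (h : Covers M a D) : Covers M a D' := by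
  induction M generalizing a with
  | nil =>
    intro d hd
    by_contra hda
    exact hda (h d ((hDD' d (not_le.1 hda)).2 hd))
  | cons g M ih =>
    obtain ⟨b, hb, h1, h2, h3⟩ := h
    have hg := hM g List.mem_cons_self
    refine ⟨b, hb, fun d h h' => (hDD' d (by omega)).1 (h1 d h h'),
      fun h => h2 ((hDD' b (by omega)).2 h), ih (fun g hg => hM g (List.mem_cons_of_mem _ hg))
        (fun d hd => hDD' d (by omega)) h3⟩

theorem Covers.erase {M : List ℕ} {a : ℕ} {D : Finset (Fin n)} (hM : ∀ g ∈ M, 1 ≤ g)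
    (h : Covers M a D) {d : Fin n} (hd : (d : ℕ) ≤ a) : Covers M a (D.erase d) :=
  h.congr hM fun x hx => by
    have : x ≠ d := by
      rintro rfl
      omega
    simp [this]

/-- The nonevasiveness argument: the sets strictly below `D` are contractible if this holds for
those avoiding the smallest element `d` of `D`, and for those containing it. In the second case
either there is a redundant element `e`, or the remaining elements have to contain a sequence with
the gaps `L`. -/
theorem contr_hasGaps_of_erase {D : Finset (Fin n)} {d : Fin n} (hd : d ∈ D)
    (hmin : ∀ x ∈ D, d ≤ x) {h : ℕ} {L : List ℕ} (hh : 1 ≤ h) (hD : HasGaps (h :: L) D)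
    (h1 : HasGaps (h :: L) (D.erase d) →
      Contr {D' | D' ⊂ D.erase d ∧ HasGaps (h :: L) D'})
    (h2 : (∀ x ∈ D.erase d, (d : ℕ) + h ≤ x) → HasGaps L (D.erase d) →
      Contr {D' | D' ⊂ D.erase d ∧ HasGaps L D'}) :
    Contr {D' | D' ⊂ D ∧ HasGaps (h :: L) D'} := by
  have hss : D.erase d ⊂ D := Finset.erase_ssubset hd
  -- Any sequence in a set containing `d` may be assumed to begin with `d`.
  have hstart : ∀ E ⊆ D, d ∈ E → HasGaps (h :: L) E →
      HasGaps L (E.filter fun b => (d : ℕ) + h ≤ b) := by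
    rintro E hED - ⟨a, ha, haE⟩
    refine haE.mono fun b hb => ?_
    have := Fin.le_def.1 (hmin a (hED ha))
    rw [Finset.mem_filter] at hb ⊢
    exact ⟨hb.1, by omega⟩
  have hwith : Contr {D' | d ∈ D' ∧ D' ⊂ D ∧ HasGaps (h :: L) D'} := by
    by_cases he : ∃ e ∈ D.erase d, (e : ℕ) < d + h
    · obtain ⟨e, heD, hed⟩ := he
      obtain ⟨hne, heD⟩ := Finset.mem_erase.1 heD
      have herase : ∀ E ⊆ D, d ∈ E → HasGaps (h :: L) E → HasGaps (h :: L) (E.erase e) := by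
        intro E hED hdE hE
        refine ⟨d, Finset.mem_erase.2 ⟨hne.symm, hdE⟩, (hstart E hED hdE hE).mono fun b hb => ?_⟩
        rw [Finset.mem_filter] at hb ⊢
        refine ⟨Finset.mem_erase.2 ⟨?_, hb.1⟩, hb.2⟩
        rintro rfl
        omega
      refine (Red.of_bottomUp (S := {D' | d ∈ D' ∧ D' ⊂ D ∧ HasGaps (h :: L) D' ∧ e ∈ D'})
        ?_ ?_).contr (.cone (D.erase e) ?_ ?_)
      · rintro E ⟨k1, k2, k3, -⟩
        exact ⟨k1, k2, k3⟩
      · rintro E ⟨k1, k2, k3, k4⟩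
        have hEe : E.erase e ⊂ E := Finset.erase_ssubset k4
        refine .cone (E.erase e) ⟨⟨⟨Finset.mem_erase.2 ⟨hne.symm, k1⟩, hEe.trans k2,
          herase E k2.subset k1 k3⟩, fun hE => Finset.notMem_erase e E hE.2.2.2⟩, hEe⟩ ?_
        rintro F ⟨⟨⟨l1, l2, l3⟩, l4⟩, l5⟩
        exact .inl (Finset.subset_erase.2 ⟨l5.le, fun heF => l4 ⟨l1, l2, l3, heF⟩⟩)
      · exact ⟨⟨Finset.mem_erase.2 ⟨hne.symm, hd⟩, Finset.erase_ssubset heD,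
          herase D subset_rfl hd hD⟩, fun hE => Finset.notMem_erase e D hE.2.2.2⟩
      · rintro F ⟨⟨l1, l2, l3⟩, l4⟩
        exact .inl (Finset.subset_erase.2 ⟨l2.subset, fun heF => l4 ⟨l1, l2, l3, heF⟩⟩)
    · push Not at he
      have hL : ∀ E ⊆ D, d ∈ E → HasGaps (h :: L) E → HasGaps L (E.erase d) := by
        refine fun E hED hdE hE => (hstart E hED hdE hE).mono fun b hb => ?_
        rw [Finset.mem_filter] at hb
        refine Finset.mem_erase.2 ⟨?_, hb.1⟩
        rintro rfl
        omega
      convert (h2 he (hL D subset_rfl hd hD)).image (f := insert d) ?_ using 1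
      · ext E
        constructor
        · rintro ⟨k1, k2, k3⟩
          refine ⟨E.erase d, ⟨?_, hL E k2.subset k1 k3⟩, Finset.insert_erase k1⟩
          refine lt_of_le_of_ne (Finset.erase_subset_erase d k2.subset) fun e => k2.ne ?_
          rw [← Finset.insert_erase k1, e, Finset.insert_erase hd]
        · rintro ⟨F, ⟨k1, k2⟩, rfl⟩
          have hdF : d ∉ F := fun hdF => Finset.notMem_erase d D (k1.subset hdF)
          refine ⟨Finset.mem_insert_self d F, ?_, d, Finset.mem_insert_self d F, k2.mono ?_⟩
          · refine lt_of_le_of_ne (Finset.insert_subset hd (k1.subset.trans hss.subset))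
              fun e => k1.ne ?_
            rw [← e, Finset.erase_insert hdF]
          · exact fun b hb => Finset.mem_filter.2 ⟨Finset.mem_insert_of_mem hb,
              he b (k1.subset hb)⟩
      · intro E hE F hF
        have hdE : d ∉ E := fun hdE => Finset.notMem_erase d D (hE.1.subset hdE)
        exact Finset.insert_subset_insert_iff hdE
  -- The sets avoiding `d` are removed, the largest of them, `D.erase d`, first.
  have hrest : Contr {D' | D' ⊂ D ∧ D' ≠ D.erase d ∧ HasGaps (h :: L) D'} := by
    refine (Red.of_topDown (S := {D' | D' ⊂ D ∧ D' ≠ D.erase d ∧ HasGaps (h :: L) D' ∧ d ∉ D'})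
      ?_ ?_).contr ?_
    · rintro E ⟨k1, k2, k3, -⟩
      exact ⟨k1, k2, k3⟩
    · rintro E ⟨k1, k2, k3, k4⟩
      right
      have hins : insert d E ⊂ D := by
        refine lt_of_le_of_ne (Finset.insert_subset hd k1.subset) fun e => k2 ?_
        rw [← e, Finset.erase_insert k4]
      refine .cone (insert d E) ⟨⟨⟨hins, fun e => ?_, k3.mono (Finset.subset_insert d E)⟩,
        fun hE => hE.2.2.2 (Finset.mem_insert_self d E)⟩, Finset.ssubset_insert k4⟩ ?_
      · exact Finset.notMem_erase d D (e ▸ Finset.mem_insert_self d E)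
      · rintro F ⟨⟨⟨l1, l2, l3⟩, l4⟩, l5⟩
        refine .inr (Finset.insert_subset ?_ l5.le)
        by_contra hdF
        exact l4 ⟨l1, l2, l3, hdF⟩
    · convert hwith using 1
      ext E
      constructor
      · rintro ⟨⟨k1, k2, k3⟩, k4⟩
        refine ⟨?_, k1, k3⟩
        by_contra hdE
        exact k4 ⟨k1, k2, k3, hdE⟩
      · rintro ⟨k1, k2, k3⟩
        refine ⟨⟨k2, fun e => ?_, k3⟩, fun hE => hE.2.2.2 k1⟩
        exact Finset.notMem_erase d D (e ▸ k1)
  by_cases hDd : HasGaps (h :: L) (D.erase d)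
  · refine .lower (D.erase d) ⟨hss, hDd⟩ ?_ ?_
    · convert h1 hDd using 3 with E
      exact ⟨fun k => ⟨k.2, k.1.2⟩, fun k => ⟨⟨k.1.trans hss, k.2⟩, k.1⟩⟩
    · convert hrest using 1
      ext E
      simp only [Set.mem_sdiff, Set.mem_ofPred_eq, Set.mem_singleton_iff]
      tauto
  · convert hrest using 3 with E
    constructor
    · exact fun k => ⟨k.1, fun e => hDd (e ▸ k.2), k.2⟩
    · exact fun k => ⟨k.1, k.2.2⟩

/-- If `D` lies above `a` and is covered by a sequence of gaps that is a final segment of `L`, then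
the proper subsets of `D` containing a sequence with gaps `L` are contractible. The induction is on
the size of `D`, and for fixed `D` on `M`; allowing a final segment `M` of `L` is needed because
removing the smallest element of `D` may use up a gap of `M` but none of `L`. -/
theorem contr_hasGaps_of_covers {L M : List ℕ} (hML : M <:+ L) (hL : ∀ g ∈ L, 2 ≤ g)
    {a : ℕ} {D : Finset (Fin n)} (ha : ∀ d ∈ D, a < (d : ℕ)) (hM : Covers M a D)
    (hD : HasGaps L D) : Contr {D' | D' ⊂ D ∧ HasGaps L D'} := by
  induction hm : D.card using Nat.strong_induction_on generalizing D L M a with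
  | _ m ihm =>
  induction M generalizing a with
  | nil =>
    obtain ⟨d, hd⟩ := hD.nonempty
    exact absurd (hM d hd) (not_le.2 (ha d hd))
  | cons g M ihM =>
    have hgL : g ∈ L := hML.subset List.mem_cons_self
    have hML' : M <:+ L := (List.suffix_cons g M).trans hML
    have hg : 2 ≤ g := hL g hgL
    have hM1 : ∀ x ∈ M, 1 ≤ x := fun x hx => one_le_two.trans (hL x (hML'.subset hx))
    obtain ⟨b, hab, hI, hb, hMb⟩ := hM
    obtain ⟨d, hd, hmin⟩ : ∃ d ∈ D, ∀ x ∈ D, d ≤ x :=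
      ⟨D.min' hD.nonempty, D.min'_mem _, fun x hx => D.min'_le x hx⟩
    have hdb : d ≠ b := fun e => hb (e ▸ hd)
    rcases lt_or_gt_of_ne hdb with hdb | hdb
    swap
    · exact ihM hML' (fun x hx => hdb.trans_le (hmin x hx)) hMb
    cases L with
    | nil => exact absurd hgL List.not_mem_nil
    | cons h L =>
    have hh : 2 ≤ h := hL h List.mem_cons_self
    have hL' : ∀ g ∈ L, 2 ≤ g := fun g hg => hL g (List.mem_cons_of_mem _ hg)
    have hcard : (D.erase d).card < m := hm ▸ Finset.card_erase_lt_of_mem hd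
    have hDd : ∀ x ∈ D.erase d, x ∈ D ∧ d < x := fun x hx =>
      ⟨Finset.mem_of_mem_erase hx, lt_of_le_of_ne (hmin x (Finset.mem_of_mem_erase hx))
        (Finset.ne_of_mem_erase hx).symm⟩
    have hMb' : Covers M b (D.erase d) := hMb.erase hM1 (Fin.lt_def.1 hdb).le
    have hb' : b ∉ D.erase d := fun h => hb (Finset.mem_of_mem_erase h)
    have had := ha d hd
    rw [Fin.lt_def] at hdb
    refine contr_hasGaps_of_erase hd hmin (by omega) hD (fun hDL => ?_) fun hfar hDL => ?_
    · rcases lt_or_ge (d : ℕ) (a + g) with hdag | hdag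
      · refine ihm _ hcard hML hL (fun x hx => ha x (hDd x hx).1) ⟨b, hab, fun x h1 h2 => ?_, hb',
          hMb'⟩ hDL rfl
        refine Finset.mem_erase.2 ⟨?_, hI x h1 h2⟩
        rintro rfl
        omega
      · -- Here `d = a + g` is the first element of the first block of `D`.
        have hdeq : (d : ℕ) = a + g := by
          have := Fin.le_def.1 (hmin ⟨a + g, by omega⟩ (hI _ le_rfl (Fin.lt_def.2 (by
            simp only; omega))))
          simp only at this
          omega
        rcases Nat.lt_or_ge (d + 1) b with hdb1 | hdb1
        · -- The first block still has elements without `d`: the point `a` moves up by one.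
          refine ihm _ hcard hML hL (a := a + 1) (fun x hx => ?_) ⟨b, by omega,
            fun x h1 h2 => ?_, hb', hMb'⟩ hDL rfl
          · have := Fin.lt_def.1 (hDd x hx).2
            omega
          · refine Finset.mem_erase.2 ⟨?_, hI x (by omega) h2⟩
            rintro rfl
            omega
        · refine ihm _ hcard hML' hL (a := b) (fun x hx => ?_) hMb' hDL rfl
          have h1 := Fin.lt_def.1 (hDd x hx).2
          have h2 : (x : ℕ) ≠ b := fun e => hb (Fin.ext e ▸ (hDd x hx).1)
          omega
    · have hML'' : M <:+ L := by
        rcases List.suffix_cons_iff.1 hML with h | h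
        · exact (List.cons.inj h).2 ▸ List.suffix_rfl
        · exact (List.suffix_cons g M).trans h
      rcases lt_or_ge (d : ℕ) (a + g) with hdag | hdag
      · rcases List.suffix_cons_iff.1 hML with h | h
        · -- The first block is empty, as its elements would be too close to `d`.
          obtain ⟨rfl, rfl⟩ := List.cons.inj h
          have hbeq : (b : ℕ) = a + g := by
            by_contra hne
            have hmem := hI ⟨a + g, by omega⟩ le_rfl (Fin.lt_def.2 (by simp only; omega))
            have := hfar ⟨a + g, by omega⟩ (Finset.mem_erase.2 ⟨fun e => by
              have := congrArg Fin.val e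
              simp only at this
              omega, hmem⟩)
            simp only at this
            omega
          exact ihm _ hcard hML'' hL' (a := b) (fun x hx => by have := hfar x hx; omega) hMb' hDL
            rfl
        · refine ihm _ hcard h hL' (fun x hx => ha x (hDd x hx).1) ⟨b, hab, fun x h1 h2 => ?_, hb',
            hMb'⟩ hDL rfl
          refine Finset.mem_erase.2 ⟨?_, hI x h1 h2⟩
          rintro rfl
          omega
      · refine ihm _ hcard hML'' hL' (a := b) (fun x hx => ?_) hMb' hDL rfl
        have h1 := hfar x hx
        have h2 : (x : ℕ) ≠ b := fun e => hb (Fin.ext e ▸ (hDd x hx).1)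
        by_contra hxb
        -- The element after `d` would lie in the first block of `D`, too close to `d`.
        have h3 := hI ⟨d + 1, by omega⟩ (by simp only; omega) (Fin.lt_def.2 (by simp only; omega))
        have h4 := hfar _ (Finset.mem_erase.2 ⟨fun e => by
          have := congrArg Fin.val e
          simp only at this
          omega, h3⟩)
        simp only at h4
        omega

/-- The complement of a set `C` is covered by the leftmost sequence in `C` if every sequence in `C`
ends in the last element. -/
theorem covers_compl {L : List ℕ} (hL : ∀ g ∈ L, 1 ≤ g) {C : Finset (Fin n)} {a l : Fin n}
    (hl : (l : ℕ) + 1 = n) (ha : a ∈ C) (h : HasGaps L (C.filter (a ≤ ·)))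
    (h' : ¬ HasGaps L ((C.erase l).filter (a ≤ ·))) : Covers L a Cᶜ := by
  induction L generalizing a with
  | nil =>
    have hal : a = l := by
      by_contra hne
      exact h' ⟨a, Finset.mem_filter.2 ⟨Finset.mem_erase.2 ⟨hne, ha⟩, le_rfl⟩⟩
    intro d _
    have := d.2
    have := congrArg Fin.val hal
    omega
  | cons g L ih =>
    have hg := hL g List.mem_cons_self
    obtain ⟨a', ha', hgaps⟩ := h
    have hgaps : HasGaps L (C.filter fun b => (a : ℕ) + g ≤ b) := hgaps.mono fun b hb => by
      simp only [Finset.mem_filter, Fin.le_def] at hb ha' ⊢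
      exact ⟨hb.1.1, by omega⟩
    obtain ⟨b, hb, hmin⟩ : ∃ b ∈ C.filter (fun b : Fin n => (a : ℕ) + g ≤ b),
        ∀ x ∈ C.filter (fun b : Fin n => (a : ℕ) + g ≤ b), b ≤ x :=
      ⟨_, Finset.min'_mem _ hgaps.nonempty, fun x hx => Finset.min'_le _ x hx⟩
    rw [Finset.mem_filter] at hb
    refine ⟨b, hb.2, fun d h1 h2 => ?_, fun h => Finset.mem_compl.1 h hb.1,
      ih (fun x hx => hL x (List.mem_cons_of_mem _ hx)) hb.1 ?_ fun hb' => h' ?_⟩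
    · rw [Finset.mem_compl]
      exact fun hd => not_le.2 h2 (hmin d (Finset.mem_filter.2 ⟨hd, h1⟩))
    · exact hgaps.mono fun x hx => Finset.mem_filter.2 ⟨(Finset.mem_filter.1 hx).1, hmin x hx⟩
    · have hal : a ≠ l := by
        rintro rfl
        have := b.2
        omega
      refine ⟨a, Finset.mem_filter.2 ⟨Finset.mem_erase.2 ⟨hal, ha⟩, le_rfl⟩,
        hb'.mono fun x hx => ?_⟩
      simp only [Finset.mem_filter, Fin.le_def] at hx ⊢
      exact ⟨⟨hx.1, by omega⟩, by omega⟩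

/-- The case needed for stable pairs: the complement of `D` contains the first element `f`, and all
its sequences with gaps `L` end in the last element `l`. -/
theorem contr_hasGaps_of_compl {L : List ℕ} (hL : ∀ g ∈ L, 2 ≤ g) {D : Finset (Fin n)}
    {f l : Fin n} (hf : (f : ℕ) = 0) (hl : (l : ℕ) + 1 = n) (hfD : f ∉ D) (hD : HasGaps L D)
    (hC : HasGaps L Dᶜ) (hC' : ¬ HasGaps L (Dᶜ.erase l)) :
    Contr {D' | D' ⊂ D ∧ HasGaps L D'} := by
  have hfilter : ∀ E : Finset (Fin n), E.filter (f ≤ ·) = E := fun E =>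
    Finset.filter_true_of_mem fun x _ => Fin.le_def.2 (by omega)
  have := covers_compl (C := Dᶜ) (fun g hg => one_le_two.trans (hL g hg)) hl
    (Finset.mem_compl.2 hfD) (by rwa [hfilter]) (by rwa [hfilter])
  rw [compl_compl] at this
  refine contr_hasGaps_of_covers List.suffix_rfl hL (fun d hd => ?_) this hD
  have : (d : ℕ) ≠ f := fun e => hfD (Fin.ext e ▸ hd)
  omega

theorem hasGaps_ofFn_iff {m : ℕ} (s : Fin m → ℕ) (A : Finset (Fin n)) :
    HasGaps (List.ofFn s) A ↔ ∃ f : Fin (m + 1) → Fin n, (∀ i, f i ∈ A) ∧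
      ∀ i : Fin m, (f i.castSucc : ℕ) + s i ≤ f i.succ := by
  induction m generalizing A with
  | zero =>
    rw [List.ofFn_zero]
    refine ⟨fun ⟨a, ha⟩ => ⟨fun _ => a, fun _ => ha, fun i => i.elim0⟩, fun ⟨f, hf, _⟩ =>
      ⟨f 0, hf 0⟩⟩
  | succ m ih =>
    rw [List.ofFn_succ]
    constructor
    · rintro ⟨a, ha, h⟩
      obtain ⟨f, hf, hgap⟩ := (ih _ _).1 h
      refine ⟨Fin.cons a f, fun i => ?_, fun i => ?_⟩
      · refine Fin.cases ha (fun i => ?_) i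
        exact (Finset.mem_filter.1 (hf i)).1
      · refine Fin.cases ?_ (fun i => ?_) i
        · exact (Finset.mem_filter.1 (hf 0)).2
        · exact hgap i
    · rintro ⟨f, hf, hgap⟩
      refine ⟨f 0, hf 0, (ih _ _).2 ⟨fun i => f i.succ, fun i => ?_, fun i => hgap i.succ⟩⟩
      refine Finset.mem_filter.2 ⟨hf _, ?_⟩
      induction i using Fin.induction with
      | zero => exact hgap 0
      | succ i ihi => exact (ihi.trans (Nat.le_add_right _ _)).trans (hgap i.succ)

end Gaps

/-! ### Stable sets -/

section Stable

variable {n k : ℕ}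

/-- `A` contains a `k`-set that is stable for the vector `(s₁, …, s_{k-1}, t)`. -/
def ContainsStable (s : Fin (k - 1) → ℕ) (t : ℕ) (A : Finset (Fin n)) : Prop :=
  ∃ S ⊆ A, IsStable (appendLast s t) S

variable {s : Fin (k - 1) → ℕ} {A B : Finset (Fin n)}

theorem monotone_containsStable (s : Fin (k - 1) → ℕ) (t : ℕ) :
    Monotone (ContainsStable (n := n) s t) :=
  fun _ _ hAB ⟨S, hS, h⟩ => ⟨S, hS.trans hAB, h⟩

theorem appendLast_of_lt (s : Fin (k - 1) → ℕ) (t : ℕ) {i j : Fin k} (hij : (j : ℕ) = i + 1) :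
    appendLast s t i = s ⟨i, by omega⟩ :=
  dif_pos _

theorem appendLast_last (s : Fin (k - 1) → ℕ) (t : ℕ) {i : Fin k} (hi : (i : ℕ) + 1 = k) :
    appendLast s t i = t :=
  dif_neg (by omega)

/-- Changing the last entry of the vector affects only the second condition of stability. -/
theorem IsStable.appendLast_congr {t t' : ℕ} (h : IsStable (appendLast s t) A)
    (h' : ∀ first ∈ A, ∀ last ∈ A, (last : ℕ) + t ≤ first + n → (last : ℕ) + t' ≤ first + n) :
    IsStable (appendLast s t') A := by
  obtain ⟨hA, h1, h2⟩ := h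
  refine ⟨hA, fun i j hij => ?_, fun i j hi hj => ?_⟩
  · have := h1 i j hij
    rwa [appendLast_of_lt s _ hij] at this ⊢
  · have := h2 i j hi hj
    rw [appendLast_last s _ hj] at this ⊢
    exact h' _ (Finset.orderEmbOfFin_mem A hA i) _ (Finset.orderEmbOfFin_mem A hA j) this

theorem ContainsStable.one_of_two (h : ContainsStable s 2 A) : ContainsStable s 1 A := by
  obtain ⟨S, hS, h⟩ := h
  exact ⟨S, hS, h.appendLast_congr fun _ _ _ _ h => by omega⟩

theorem ContainsStable.two_of_first_notMem (h : ContainsStable s 1 A) {f : Fin n}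
    (hf : (f : ℕ) = 0) (hfA : f ∉ A) : ContainsStable s 2 A := by
  obtain ⟨S, hS, h⟩ := h
  refine ⟨S, hS, h.appendLast_congr fun x hx y _ _ => ?_⟩
  have : (x : ℕ) ≠ f := fun e => hfA (Fin.ext e ▸ hS hx)
  omega

theorem ContainsStable.two_of_last_notMem (h : ContainsStable s 1 A) {l : Fin n}
    (hl : (l : ℕ) + 1 = n) (hlA : l ∉ A) : ContainsStable s 2 A := by
  obtain ⟨S, hS, h⟩ := h
  refine ⟨S, hS, h.appendLast_congr fun x _ y hy _ => ?_⟩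
  have : (y : ℕ) ≠ l := fun e => hlA (Fin.ext e ▸ hS hy)
  omega

theorem containsStable_one_iff (hk : 1 ≤ k) (hs : ∀ i, 1 ≤ s i) :
    ContainsStable s 1 A ↔ HasGaps (List.ofFn s) A := by
  obtain ⟨m, rfl⟩ : ∃ m, k = m + 1 := ⟨k - 1, by omega⟩
  refine Iff.trans ?_ (hasGaps_ofFn_iff (m := m) s A).symm
  constructor
  · rintro ⟨S, hSA, hS, h1, -⟩
    refine ⟨S.orderEmbOfFin hS, fun i => hSA (Finset.orderEmbOfFin_mem S hS i), fun i => ?_⟩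
    have hi : ((i.succ : Fin (m + 1)) : ℕ) = i.castSucc + 1 := by simp
    have := h1 i.castSucc i.succ hi
    rwa [appendLast_of_lt s _ hi] at this
  · rintro ⟨f, hfA, hf⟩
    have hmono : StrictMono f := Fin.strictMono_iff_lt_succ.2 fun i => by
      have := hf i
      have := hs i
      exact Fin.lt_def.2 (by omega)
    have hcard : (Finset.univ.image f).card = m + 1 := by
      rw [Finset.card_image_of_injective _ hmono.injective, Finset.card_univ, Fintype.card_fin]
    have hemb : f = (Finset.univ.image f).orderEmbOfFin hcard :=
      Finset.orderEmbOfFin_unique hcard (fun i => Finset.mem_image_of_mem f (Finset.mem_univ i))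
        hmono
    refine ⟨Finset.univ.image f, ?_, hcard, ?_, ?_⟩
    · intro a ha
      obtain ⟨i, -, rfl⟩ := Finset.mem_image.1 ha
      exact hfA i
    · intro i j hij
      rw [appendLast_of_lt s _ hij, ← hemb]
      have := hf ⟨i, by omega⟩
      have hj : j = Fin.succ ⟨i, by omega⟩ := Fin.ext hij
      exact this.trans (congrArg (fun x => (f x : ℕ)) hj.symm).le
    · intro i j _ hj
      rw [appendLast_last s _ hj]
      have := ((Finset.univ.image f).orderEmbOfFin hcard j).2
      omega

/-- The condition of `red_disjointPairs` for replacing the last entry `1` of the vector by `2`: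
the complement of `B` contains stable sets, but each of them contains both the first and the last
element of the ground set. -/
theorem contr_containsStable_lt (hk : 1 ≤ k) (hs : ∀ i, 2 ≤ s i) {v : Finset (Fin n) → Prop}
    (hv : ∀ A, v A → ContainsStable s 1 A) (hv' : ∀ A, ContainsStable s 2 A → v A)
    (hB : v B) (hC : ContainsStable s 1 Bᶜ) (hC' : ¬ ContainsStable s 2 Bᶜ) :
    Contr {B' | B' ⊂ B ∧ v B'} := by
  have hs1 : ∀ i, 1 ≤ s i := fun i => one_le_two.trans (hs i)
  have hpos : 0 < n := by
    obtain ⟨a, -⟩ := ((containsStable_one_iff hk hs1).1 hC).nonempty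
    exact a.pos
  let f : Fin n := ⟨0, hpos⟩
  let l : Fin n := ⟨n - 1, by omega⟩
  have hl : (l : ℕ) + 1 = n := Nat.sub_add_cancel hpos
  have hfB : f ∉ B := fun h => hC' (hC.two_of_first_notMem rfl (by simpa using h))
  have hlast : ¬ ContainsStable s 1 (Bᶜ.erase l) := fun h => hC' <|
    monotone_containsStable s 2 (Finset.erase_subset l Bᶜ)
      (h.two_of_last_notMem hl (Finset.notMem_erase l _))
  rw [containsStable_one_iff hk hs1] at hC hlast
  convert contr_hasGaps_of_compl (L := List.ofFn s) (fun g hg => ?_) (f := f) rfl hl hfB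
    ((containsStable_one_iff hk hs1).1 (hv B hB)) hC hlast using 3 with B'
  · refine and_congr_right fun hB' => ⟨fun h => (containsStable_one_iff hk hs1).1 (hv B' h),
      fun h => hv' _ ?_⟩
    exact ((containsStable_one_iff hk hs1).2 h).two_of_first_notMem (f := f) rfl
      fun h => hfB (hB'.subset h)
  · obtain ⟨i, rfl⟩ := (List.mem_ofFn' s g).1 hg
    exact hs i

/-- The realization of the order complex of `P(n, k, s)`, formed inside the poset of all pairs. -/
theorem nonempty_homeomorph_stablePairs (s : Fin (k - 1) → ℕ) (t : ℕ) :
    Nonempty (GeometricRealization (orderComplex (StablePairs n k (appendLast s t))) ≃ₜ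
      Realization (chainsIn (disjointPairs (ι := Fin n) (ContainsStable s t)
        (ContainsStable s t)))) := by
  have hfaces : ∀ x : StablePairs n k (appendLast s t) → ℝ,
      (x ∈ stdSimplex ℝ (StablePairs n k (appendLast s t)) ∧
        ∃ F ∈ (orderComplex (StablePairs n k (appendLast s t))).faces, ∀ v, x v ≠ 0 → v ∈ F) ↔
      x ∈ stdSimplex ℝ _ ∧ Function.support x ∈
        {τ : Set (StablePairs n k (appendLast s t)) | IsChain (· ≤ ·) τ} := by
    intro x
    refine and_congr_right fun hx => ⟨fun ⟨F, hF, hxF⟩ => hF.2.mono hxF, fun h => ?_⟩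
    refine ⟨(Function.support x).toFinite.toFinset, ⟨?_, ?_⟩, fun v hv => ?_⟩
    · obtain ⟨v, hv⟩ : ∃ v, x v ≠ 0 := by
        by_contra! h0
        have := hx.2
        simp [h0] at this
      exact ⟨v, by simpa using hv⟩
    · rw [Set.Finite.coe_toFinset]
      exact h
    · simpa using hv
  obtain ⟨e⟩ := Realization.nonempty_homeomorph_of_injective
    (f := (Subtype.val : StablePairs n k (appendLast s t) → _)) Subtype.val_injective
    (K := {τ : Set (StablePairs n k (appendLast s t)) | IsChain (· ≤ ·) τ})
    (K' := chainsIn (disjointPairs (ContainsStable s t) (ContainsStable s t))) (by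
      ext τ
      constructor
      · rintro ⟨h1, h2⟩
        refine ⟨Subtype.val ⁻¹' τ, ?_, ?_⟩
        · intro x hx y hy _
          exact h2.total hx hy
        · exact (Subtype.image_preimage_coe _ _).trans (Set.inter_eq_right.2 h1)
      · rintro ⟨τ, h, rfl⟩
        refine ⟨?_, ?_⟩
        · rintro _ ⟨p, -, rfl⟩
          exact p.2
        · rintro _ ⟨p, hp, rfl⟩ _ ⟨q, hq, rfl⟩ -
          have h : IsChain (· ≤ ·) τ := h
          exact h.total hp hq)
  exact ⟨(Homeomorph.setCongr (Set.ext hfaces)).trans e⟩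

end Stable

theorem mainTheorem4 (n k : ℕ) (hk : 2 ≤ k) (s : Fin (k - 1) → ℕ) (hs : ∀ i, 2 ≤ s i)
    (hn : ∑ i, s i + 2 ≤ n) :
    Nonempty (ContinuousMap.HomotopyEquiv
      (GeometricRealization (orderComplex (StablePairs n k (appendLast s 1))))
      (GeometricRealization (orderComplex (StablePairs n k (appendLast s 2))))) := by
  have hk1 : 1 ≤ k := one_le_two.trans hk
  have h21 : ∀ A : Finset (Fin n), ContainsStable s 2 A → ContainsStable s 1 A :=
    fun _ h => h.one_of_two
  have hmono := monotone_containsStable (n := n) s 1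
  obtain ⟨e₁⟩ := nonempty_homeomorph_stablePairs (n := n) s 1
  obtain ⟨e₂⟩ := (red_disjointPairs (v := ContainsStable s 1) h21 hmono
    fun B => contr_containsStable_lt hk1 hs (fun _ => id) h21).homotopyEquiv
  obtain ⟨e₃⟩ := nonempty_homeomorph_disjointPairs_swap (ι := Fin n) (ContainsStable s 2)
    (ContainsStable s 1)
  obtain ⟨e₄⟩ := (red_disjointPairs (v := ContainsStable s 2) h21 hmono
    fun B => contr_containsStable_lt hk1 hs h21 fun _ => id).homotopyEquiv
  obtain ⟨e₅⟩ := nonempty_homeomorph_stablePairs (n := n) s 2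
  exact ⟨e₁.toHomotopyEquiv.trans <| e₂.trans <| e₃.toHomotopyEquiv.trans <| e₄.trans
    e₅.symm.toHomotopyEquiv⟩
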